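/- A sequence $(a_n)_{n\in\omega}$ in a group $G$ is called a $T$-sequence if it converges to zero (the neutral element) in some non-discrete Hausdorff group topology on $G$. A group topology $\tau$ on $G$ is determined by a $T$-sequence if there is a $T$-sequence $(a_n)_{n\in\omega}$ in $G$ such that $\tau$ is the strongest group topology on $G$ in which $(a_n)$ converges to zero. For two group topologies $\tau_1,\tau_2$ on $G$, $\tau_1\vee\tau_2$ denotes the weakest topology $\tau$ on $G$ such that the identity maps $(G,\tau)\to(G,\tau_i)$, $i=1,2$, are continuous. A Hausdorff topological group $G$ is a $k_\omega$-group if it admits a countable cover $\mathcal K$ by compact subspaces such that a subset $U\subset G$ is open in $G$ if and only if $U\cap K$ is open in $K$ for every $K\in\mathcal K$. Corollary 1. There exist a countable Abelian group $G$ and two group topologies $\tau_1,\tau_2$ on $G$, each determined by a $T$-sequence, such that $(G,\tau_1\vee\tau_2)$ is a $k_\omega$-group which is not determined by a $T$-sequence. -/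

import Mathlib

open Filter Topology

/-- The sequence `a` converges to zero in the group topology `τ` on `G`. -/
def ConvergesToZero {G : Type*} [AddGroup G] (τ : AddGroupTopology G) (a : ℕ → G) : Prop :=
  Tendsto a atTop (@nhds G τ.toTopologicalSpace 0)

/-- `a` is a `T`-sequence in `G`: it converges to zero in some non-discrete Hausdorff
group topology on `G`. -/
def IsTSequence {G : Type*} [AddGroup G] (a : ℕ → G) : Prop :=
  ∃ τ : AddGroupTopology G,
    @T2Space G τ.toTopologicalSpace ∧ ¬ @DiscreteTopology G τ.toTopologicalSpace ∧
      ConvergesToZero τ a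

/-- `τ` is the strongest group topology on `G` in which the sequence `a` converges to zero.
In Mathlib's order on group topologies, `τ ≤ σ` says that every `σ`-open set is `τ`-open,
i.e. that `τ` is stronger (finer) than `σ`. -/
def IsStrongestTopologyFor {G : Type*} [AddGroup G] (τ : AddGroupTopology G) (a : ℕ → G) : Prop :=
  ConvergesToZero τ a ∧ ∀ σ : AddGroupTopology G, ConvergesToZero σ a → τ ≤ σ

/-- The topological group `(G, τ)` is determined by a `T`-sequence. -/
def IsDeterminedByTSequence {G : Type*} [AddGroup G] (τ : AddGroupTopology G) : Prop :=
  ∃ a : ℕ → G, IsTSequence a ∧ IsStrongestTopologyFor τ a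

/-- The supremum `τ₁ ∨ τ₂`: the weakest topology for which both identity maps onto `(G, τ₁)` and
`(G, τ₂)` are continuous. As Mathlib orders topologies by reverse inclusion of their open sets,
it is an infimum there. -/
def joinTopology {G : Type*} [AddGroup G] (τ₁ τ₂ : AddGroupTopology G) : AddGroupTopology G :=
  τ₁ ⊓ τ₂

/-- The topological group `(G, τ)` is a `k_ω`-group: it is Hausdorff and has a countable cover `𝒦`
by compact subsets such that `U` is open in `G` if and only if `U ∩ K` is open in `K` for every
`K ∈ 𝒦`. -/
def IsKOmegaGroup {G : Type*} [AddGroup G] (τ : AddGroupTopology G) : Prop :=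
  letI : TopologicalSpace G := τ.toTopologicalSpace
  T2Space G ∧ ∃ 𝒦 : Set (Set G), 𝒦.Countable ∧ (∀ K ∈ 𝒦, IsCompact K) ∧ ⋃₀ 𝒦 = Set.univ ∧
    ∀ U : Set G, IsOpen U ↔ ∀ K ∈ 𝒦, IsOpen ((↑) ⁻¹' U : Set K)

open scoped Pointwise

/-! ### Strongest group topologies -/

section General

variable {G : Type*} [AddCommGroup G]

/-! Let `G` be the Boolean group with basis e(m,n,l), and let b(m,n) be the sum of e(m,n,l) over l ≤
m. Take τ₁ strongest with the basis converging to zero, τ₂ strongest with the blocks b converging to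
zero.

In the join each row b(m,·) tends to zero, being a sum of m + 1 null sequences in τ₁; the growing
block length prevents this from being uniform in m. Indeed a τ₁-neighborhood meets the τ₂-open span
of the blocks in sums where a block of row m costs m + 1 labels, so it can be given a label at least
m (`inter_avoidingSet_subset_blockSums`). Hence every `blockSums blockElt g` is a neighborhood of
zero. Conversely, a set containing zero with relatively open traces on certain compact sums of row
tails contains some `blockSums` (`exists_blockSums_subset`), which gives the k_ω property.

If a single sequence determined the join, it would eventually lie in finitely many rows
(`exists_eventually_mem_rowSubgroup`). The subgroup of these rows would then be open, yet the next
row of blocks tends to zero outside it. -/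

/-- The strongest group topology in which `a` converges to zero. -/
def strongestTopology (a : ℕ → G) : AddGroupTopology G :=
  sInf {σ | ConvergesToZero σ a}

theorem isStrongestTopologyFor_strongestTopology (a : ℕ → G) :
    IsStrongestTopologyFor (strongestTopology a) a := by
  refine ⟨?_, fun σ hσ => sInf_le hσ⟩
  unfold ConvergesToZero strongestTopology
  rw [AddGroupTopology.toTopologicalSpace_sInf, nhds_sInf, tendsto_iInf]
  intro t
  rw [tendsto_iInf]
  rintro ⟨σ, hσ, rfl⟩
  exact hσ

/-- The subgroup `H` alone, as a base of neighborhoods of zero for a group topology. -/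
@[reducible]
def subgroupFilterBasis (H : AddSubgroup G) : AddGroupFilterBasis G :=
  addGroupFilterBasisOfComm {(H : Set G)} (Set.singleton_nonempty _)
    (by rintro _ _ rfl rfl; exact ⟨_, rfl, by simp⟩)
    (by rintro _ rfl; exact H.zero_mem)
    (by
      rintro _ rfl
      refine ⟨_, rfl, ?_⟩
      rintro _ ⟨x, hx, y, hy, rfl⟩
      exact H.add_mem hx hy)
    (by rintro _ rfl; exact ⟨_, rfl, fun x hx => H.neg_mem hx⟩)

/-- If all members of a group filter basis eventually contain `a`, they are neighborhoods of zero
for the strongest topology in which `a` converges to zero. -/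
theorem IsStrongestTopologyFor.mem_nhds_of_filterBasis {τ : AddGroupTopology G} {a : ℕ → G}
    (h : IsStrongestTopologyFor τ a) (B : AddGroupFilterBasis G)
    (hB : ∀ U ∈ B.sets, ∀ᶠ n in atTop, a n ∈ U) {U : Set G} (hU : U ∈ B.sets) :
    U ∈ @nhds G τ.toTopologicalSpace 0 := by
  let σ : AddGroupTopology G := ⟨B.topology, B.isTopologicalAddGroup⟩
  have hσ : ConvergesToZero σ a := by
    refine B.nhds_zero_hasBasis.tendsto_right_iff.2 fun V hV => hB V hV
  exact nhds_mono (h.2 σ hσ) (B.mem_nhds_zero hU)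

/-! ### Sums of row tails and the k_ω property -/

/-- Finite sums of distinct terms of a double sequence `a`, where the terms can be injectively
numbered so that the term numbered `i` lies in a row at most `i` and in a column at least `g i`. -/
def blockSums (a : ℕ × ℕ → G) (g : ℕ → ℕ) : Set G :=
  {x | ∃ (S : Finset (ℕ × ℕ)) (ψ : ℕ × ℕ → ℕ), Set.InjOn ψ S ∧
    (∀ s ∈ S, s.1 ≤ ψ s ∧ g (ψ s) ≤ s.2) ∧ x = ∑ s ∈ S, a s}

/-- Zero together with the terms of `a` in rows at most `k` and columns at least `N`. -/
def rowTails (a : ℕ × ℕ → G) (k N : ℕ) : Set G :=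
  ⋃ m ∈ Finset.range (k + 1), insert 0 (Set.range fun n => a (m, n + N))

theorem zero_mem_rowTails (a : ℕ × ℕ → G) (k N : ℕ) : (0 : G) ∈ rowTails a k N := by
  simp only [rowTails, Set.mem_iUnion]
  exact ⟨0, by simp, by simp⟩

theorem mem_rowTails (a : ℕ × ℕ → G) {k N : ℕ} {s : ℕ × ℕ} (h1 : s.1 ≤ k) (h2 : N ≤ s.2) :
    a s ∈ rowTails a k N := by
  simp only [rowTails, Set.mem_iUnion]
  refine ⟨s.1, by simp; omega, Or.inr ⟨s.2 - N, ?_⟩⟩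
  simp [Nat.sub_add_cancel h2]

theorem rowTails_subset (a : ℕ × ℕ → G) (k N : ℕ) : rowTails a k N ⊆ rowTails a k 0 := by
  intro x hx
  simp only [rowTails, Set.mem_iUnion] at hx
  obtain ⟨m, hm, rfl | ⟨n, rfl⟩⟩ := hx
  · exact zero_mem_rowTails a k 0
  · exact mem_rowTails a (by simpa [Nat.lt_succ_iff] using hm) (Nat.zero_le _)

/-- The sums of `E 0 + ⋯ + E (k - 1)`. -/
def iteratedSum (E : ℕ → Set G) : ℕ → Set G
  | 0 => {0}
  | k + 1 => iteratedSum E k + E k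

theorem sum_mem_iteratedSum (E : ℕ → Set G) (e : ℕ → G) (he : ∀ i, e i ∈ E i) (k : ℕ) :
    ∑ i ∈ Finset.range k, e i ∈ iteratedSum E k := by
  induction k with
  | zero => simp [iteratedSum]
  | succ k ih =>
    rw [Finset.sum_range_succ]
    exact Set.add_mem_add ih (he k)

theorem iteratedSum_subset_succ {a : ℕ × ℕ → G} (k : ℕ) :
    iteratedSum (fun i => rowTails a i 0) k ⊆ iteratedSum (fun i => rowTails a i 0) (k + 1) :=
  fun x hx => ⟨x, hx, 0, zero_mem_rowTails a k 0, add_zero x⟩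

/-- Grouping terms by number leaves at most one term per number; unused numbers contribute zero. -/
theorem blockSums_subset_iUnion (a : ℕ × ℕ → G) (g : ℕ → ℕ) :
    blockSums a g ⊆ ⋃ k, iteratedSum (fun i => rowTails a i (g i)) k := by
  classical
  rintro x ⟨S, ψ, hinj, hS, rfl⟩
  refine Set.mem_iUnion.2 ⟨S.sup ψ + 1, ?_⟩
  rw [← Finset.sum_fiberwise_of_maps_to (t := Finset.range (S.sup ψ + 1)) (g := ψ)
    (fun s hs => Finset.mem_range.2 (Nat.lt_succ_of_le (Finset.le_sup hs)))]
  refine sum_mem_iteratedSum _ (fun i => ∑ s ∈ S with ψ s = i, a s) (fun i => ?_) _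
  by_cases h : ∃ s ∈ S, ψ s = i
  · obtain ⟨s, hs, rfl⟩ := h
    have : S.filter (fun t => ψ t = ψ s) = {s} := by
      ext t
      simp only [Finset.mem_filter, Finset.mem_singleton]
      exact ⟨fun ht => hinj ht.1 hs ht.2, by rintro rfl; exact ⟨hs, rfl⟩⟩
    simp only [this, Finset.sum_singleton]
    exact mem_rowTails a (hS s hs).1 (hS s hs).2
  · have : S.filter (fun t => ψ t = i) = ∅ := by
      ext t
      simpa using fun ht hi => h ⟨t, ht, hi⟩
    simp only [this, Finset.sum_empty]
    exact zero_mem_rowTails a _ _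

section Topological

variable [TopologicalSpace G]

theorem isCompact_rowTails {a : ℕ × ℕ → G}
    (ha : ∀ m, Tendsto (fun n => a (m, n)) atTop (𝓝 0)) (k N : ℕ) :
    IsCompact (rowTails a k N) := by
  refine (Finset.range (k + 1)).isCompact_biUnion fun m _ => ?_
  exact ((tendsto_add_atTop_iff_nat N).2 (ha m)).isCompact_insert_range

variable [IsTopologicalAddGroup G]

theorem isCompact_iteratedSum {E : ℕ → Set G} (hE : ∀ k, IsCompact (E k)) (k : ℕ) :
    IsCompact (iteratedSum E k) := by
  induction k with
  | zero => exact isCompact_singleton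
  | succ k ih => exact ih.add (hE k)

/-- A set containing zero whose traces on the compact sets `iteratedSum` are relatively open
contains some `blockSums`. -/
theorem exists_blockSums_subset {a : ℕ × ℕ → G}
    (ha : ∀ m, Tendsto (fun n => a (m, n)) atTop (𝓝 0)) {U : Set G} (h0 : 0 ∈ U)
    (hU : ∀ k, ∃ O, IsOpen O ∧ ∀ x ∈ iteratedSum (fun i => rowTails a i 0) k, x ∈ O ↔ x ∈ U) :
    ∃ g, blockSums a g ⊆ U := by
  set Q := iteratedSum (fun i => rowTails a i 0)
  -- Compactness leaves room for a neighborhood of zero around `C`, and only the finitely many rows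
  -- up to `k` must enter it. The hypotheses on `C` come after `N` so that `N` can be chosen as a
  -- function; otherwise its value is 0.
  have step : ∀ (k : ℕ) (C : Set G), ∃ N, IsCompact C → C ⊆ Q k → C ⊆ U →
      C + rowTails a k N ⊆ U := by
    intro k C
    by_cases hC : IsCompact C ∧ C ⊆ Q k ∧ C ⊆ U
    · obtain ⟨hC, hCQ, hCU⟩ := hC
      obtain ⟨O, hO, hOU⟩ := hU (k + 1)
      have hCQ' : C ⊆ Q (k + 1) := hCQ.trans (iteratedSum_subset_succ k)
      obtain ⟨V, hV, hCV⟩ := compact_open_separated_add_right hC hO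
        (fun x hx => (hOU x (hCQ' hx)).2 (hCU hx))
      have hev : ∀ᶠ n in atTop, ∀ m ∈ Finset.range (k + 1), a (m, n) ∈ V :=
        (eventually_all_finset _).2 fun m _ => ha m hV
      obtain ⟨N, hN⟩ := eventually_atTop.1 hev
      refine ⟨N, fun _ _ _ => ?_⟩
      rintro _ ⟨x, hx, y, hy, rfl⟩
      have hxy : x + y ∈ Q (k + 1) := Set.add_mem_add (hCQ hx) (rowTails_subset a k N hy)
      refine (hOU _ hxy).1 (hCV (Set.add_mem_add hx ?_))
      simp only [rowTails, Set.mem_iUnion] at hy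
      obtain ⟨m, hm, rfl | ⟨n, rfl⟩⟩ := hy
      · exact mem_of_mem_nhds hV
      · exact hN _ (Nat.le_add_left _ _) m hm
    · exact ⟨0, fun h1 h2 h3 => absurd ⟨h1, h2, h3⟩ hC⟩
  choose N hN using step
  let C : ℕ → Set G := fun k => Nat.rec {0} (fun k C => C + rowTails a k (N k C)) k
  have hC : ∀ k, IsCompact (C k) ∧ C k ⊆ Q k ∧ C k ⊆ U := by
    intro k
    induction k with
    | zero => exact ⟨isCompact_singleton, subset_rfl, by simpa [C] using h0⟩
    | succ k ih =>
      exact ⟨ih.1.add (isCompact_rowTails ha _ _),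
        Set.add_subset_add ih.2.1 (rowTails_subset a _ _), hN k _ ih.1 ih.2.1 ih.2.2⟩
  refine ⟨fun k => N k (C k), (blockSums_subset_iUnion a _).trans (Set.iUnion_subset fun k => ?_)⟩
  have : iteratedSum (fun i => rowTails a i (N i (C i))) k = C k := by
    induction k with
    | zero => rfl
    | succ k ih => simp only [iteratedSum, ih]; rfl
  rw [this]
  exact (hC k).2.2

/-- The cover consists of all translates of the compact sums; translating to zero reduces openness
at a point to `exists_blockSums_subset`. -/
theorem exists_countable_compact_cover [Countable G] {a : ℕ × ℕ → G}
    (ha : ∀ m, Tendsto (fun n => a (m, n)) atTop (𝓝 0)) (hD : ∀ g, blockSums a g ∈ 𝓝 (0 : G)) :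
    ∃ 𝒦 : Set (Set G), 𝒦.Countable ∧ (∀ K ∈ 𝒦, IsCompact K) ∧ ⋃₀ 𝒦 = Set.univ ∧
      ∀ U : Set G, IsOpen U ↔ ∀ K ∈ 𝒦, IsOpen ((↑) ⁻¹' U : Set K) := by
  set Q := iteratedSum (fun i => rowTails a i 0)
  refine ⟨Set.range fun p : G × ℕ => (fun x => p.1 + x) '' Q p.2, Set.countable_range _, ?_, ?_, ?_⟩
  · rintro _ ⟨p, rfl⟩
    exact (isCompact_iteratedSum (fun k => isCompact_rowTails ha k 0) p.2).image
      (continuous_const.add continuous_id)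
  · refine Set.eq_univ_of_forall fun x => ⟨_, ⟨(x, 0), rfl⟩, 0, rfl, add_zero x⟩
  · refine fun U => ⟨fun hU K _ => hU.preimage continuous_subtype_val, fun hU => ?_⟩
    rw [isOpen_iff_mem_nhds]
    intro z hz
    obtain ⟨g, hg⟩ := exists_blockSums_subset ha (U := (fun x => z + x) ⁻¹' U) (by simpa using hz) (by
      intro k
      obtain ⟨O, hO, hOU⟩ := isOpen_induced_iff.1 (hU _ ⟨(z, k), rfl⟩)
      refine ⟨(fun x => z + x) ⁻¹' O, hO.preimage (continuous_const.add continuous_id), ?_⟩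
      intro x hx
      exact Set.ext_iff.1 hOU ⟨z + x, x, hx, rfl⟩)
    have h1 : (fun x => z + x) ⁻¹' U ∈ 𝓝 (0 : G) := mem_of_superset (hD g) hg
    have h2 : Tendsto (fun y => -z + y) (𝓝 z) (𝓝 0) := by
      have : Continuous fun y => -z + y := continuous_const.add continuous_id
      simpa using this.tendsto z
    filter_upwards [h2 h1] with y hy
    simpa using hy

end Topological

end General

/-! ### The Boolean group and its blocks -/

/-- The Boolean group with a basis indexed by triples of natural numbers. -/
abbrev BooleanGroup : Type := ℕ × ℕ × ℕ →₀ ZMod 2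

namespace BooleanGroup

/-- The basis of the Boolean group. -/
noncomputable def basisElt (j : ℕ × ℕ × ℕ) : BooleanGroup := Finsupp.single j 1

/-- The sum of the first `m + 1` basis elements in the line through `(m, n)`. -/
noncomputable def blockElt (s : ℕ × ℕ) : BooleanGroup :=
  ∑ l ∈ Finset.range (s.1 + 1), basisElt (s.1, s.2, l)

theorem blockElt_apply (s : ℕ × ℕ) (m n l : ℕ) :
    blockElt s (m, n, l) = if s = (m, n) ∧ l ≤ m then 1 else 0 := by
  obtain ⟨p, q⟩ := s
  simp only [blockElt, basisElt, Finsupp.finsetSum_apply, Finsupp.single_apply, Prod.mk.injEq]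
  by_cases h : p = m ∧ q = n
  · obtain ⟨rfl, rfl⟩ := h
    simp [Finset.sum_ite_eq']
  · rw [if_neg (fun h' => h h'.1)]
    exact Finset.sum_eq_zero fun i _ => if_neg fun h' => h ⟨h'.1, h'.2.1⟩

/-- The span of the block elements. -/
def blockSubgroup : AddSubgroup BooleanGroup where
  carrier := {x | ∀ m n l, x (m, n, l) = if l ≤ m then x (m, n, 0) else 0}
  zero_mem' := by simp
  add_mem' := by
    intro x y hx hy m n l
    simp only [Finsupp.add_apply, hx m n l, hy m n l]
    split_ifs <;> simp
  neg_mem' := by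
    intro x hx m n l
    simp only [Finsupp.neg_apply, hx m n l]
    split_ifs <;> simp

theorem mem_blockSubgroup {x : BooleanGroup} :
    x ∈ blockSubgroup ↔ ∀ m n l, x (m, n, l) = if l ≤ m then x (m, n, 0) else 0 := Iff.rfl

theorem blockElt_mem_blockSubgroup (s : ℕ × ℕ) : blockElt s ∈ blockSubgroup := by
  intro m n l
  simp only [blockElt_apply]
  split_ifs <;> simp_all

theorem eq_sum_blockElt {x : BooleanGroup} (hx : x ∈ blockSubgroup) :
    x = ∑ s ∈ x.support.image fun j => (j.1, j.2.1), blockElt s := by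
  ext ⟨m, n, l⟩
  have hmem : (m, n) ∈ x.support.image (fun j => (j.1, j.2.1)) ↔ x (m, n, 0) ≠ 0 := by
    simp only [Finset.mem_image, Finsupp.mem_support_iff, Prod.exists, Prod.mk.injEq]
    constructor
    · rintro ⟨_, _, l, h, rfl, rfl⟩ h0
      exact h (by rw [hx, h0, ite_self])
    · exact fun h => ⟨m, n, 0, h, rfl, rfl⟩
  rw [Finsupp.finsetSum_apply, hx m n l]
  simp only [blockElt_apply]
  by_cases hl : l ≤ m
  · simp only [hl, and_true, if_true, Finset.sum_ite_eq', hmem]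
    -- A nonzero coefficient in `ZMod 2` equals 1.
    generalize x (m, n, 0) = t
    revert t
    decide
  · simp [hl]

/-! ### Neighborhoods of zero avoiding finite sets -/

/-- The elements whose support can be injectively numbered so that `f i` omits the point
numbered `i`. -/
def avoidingSet (f : ℕ → Finset (ℕ × ℕ × ℕ)) : Set BooleanGroup :=
  {x | ∃ φ : ℕ × ℕ × ℕ → ℕ, Set.InjOn φ x.support ∧ ∀ j ∈ x.support, j ∉ f (φ j)}

theorem avoidingSet_mono {f g : ℕ → Finset (ℕ × ℕ × ℕ)} (h : ∀ i, f i ⊆ g i) :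
    avoidingSet g ⊆ avoidingSet f :=
  fun _ ⟨φ, h1, h2⟩ => ⟨φ, h1, fun j hj hf => h2 j hj (h _ hf)⟩

/-- Even labels for the support of the first summand and odd ones for the remaining points keep the
numbering injective. -/
theorem avoidingSet_add (f : ℕ → Finset (ℕ × ℕ × ℕ)) :
    avoidingSet (fun i => f (2 * i) ∪ f (2 * i + 1)) +
      avoidingSet (fun i => f (2 * i) ∪ f (2 * i + 1)) ⊆ avoidingSet f := by
  rintro _ ⟨x, ⟨φ, hφ, hφ'⟩, y, ⟨ψ, hψ, hψ'⟩, rfl⟩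
  have key : ∀ j ∈ (x + y).support, j ∉ x.support → j ∈ y.support := by
    intro j hj hx
    simp only [Finsupp.mem_support_iff, Finsupp.add_apply, not_not] at *
    simpa [hx] using hj
  refine ⟨fun j => if j ∈ x.support then 2 * φ j else 2 * ψ j + 1, ?_, ?_⟩
  · intro i hi j hj hij
    by_cases h1 : i ∈ x.support <;> by_cases h2 : j ∈ x.support <;>
      simp only [h1, h2, if_true, if_false] at hij
    · exact hφ h1 h2 (by omega)
    · omega
    · omega
    · exact hψ (key i hi h1) (key j hj h2) (by omega)
  · intro j hj
    by_cases h : j ∈ x.support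
    · simp only [h, if_true]
      exact fun h' => hφ' j h (Finset.mem_union_left _ h')
    · simp only [h, if_false]
      exact fun h' => hψ' j (key j hj h) (Finset.mem_union_right _ h')

/-- The sets `avoidingSet` as a base of neighborhoods of zero for a group topology. -/
@[reducible]
noncomputable def avoidingBasis : AddGroupFilterBasis BooleanGroup :=
  addGroupFilterBasisOfComm (Set.range avoidingSet) (Set.range_nonempty _)
    (by
      rintro _ _ ⟨f, rfl⟩ ⟨g, rfl⟩
      exact ⟨_, ⟨fun i => f i ∪ g i, rfl⟩, Set.subset_inter
        (avoidingSet_mono fun i => Finset.subset_union_left)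
        (avoidingSet_mono fun i => Finset.subset_union_right)⟩)
    (by rintro _ ⟨f, rfl⟩; exact ⟨fun _ => 0, by simp, by simp⟩)
    (by rintro _ ⟨f, rfl⟩; exact ⟨_, ⟨_, rfl⟩, avoidingSet_add f⟩)
    (by
      rintro _ ⟨f, rfl⟩
      refine ⟨_, ⟨f, rfl⟩, ?_⟩
      rintro x ⟨φ, h⟩
      exact ⟨φ, by rwa [Finsupp.support_neg]⟩)

theorem basisElt_mem_avoidingSet {f : ℕ → Finset (ℕ × ℕ × ℕ)} {j : ℕ × ℕ × ℕ} (h : j ∉ f 0) :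
    basisElt j ∈ avoidingSet f := by
  have hs : ∀ i ∈ (basisElt j).support, i = j := fun i hi =>
    Finset.mem_singleton.1 (Finsupp.support_single_subset hi)
  refine ⟨fun _ => 0, fun i hi k hk _ => (hs i hi).trans (hs k hk).symm, fun i hi => ?_⟩
  rwa [hs i hi]

/-- Number each block by the largest label among its points. At label i ≥ m, the row and third index
of the point are at most i, so avoiding the box forces the column to be at least `g i`. -/
theorem inter_avoidingSet_subset_blockSums (g : ℕ → ℕ) :
    (blockSubgroup : Set BooleanGroup) ∩ avoidingSet (fun i => Finset.range (i + 1) ×ˢ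
      Finset.range (g i) ×ˢ Finset.range (i + 1)) ⊆ blockSums blockElt g := by
  rintro x ⟨hx, φ, hφ, hφ'⟩
  have hsupp : ∀ s ∈ x.support.image (fun j => (j.1, j.2.1)), ∀ l ∈ Finset.range (s.1 + 1),
      (s.1, s.2, l) ∈ x.support := by
    intro s hs l hl
    obtain ⟨⟨m, n, l'⟩, hj, rfl⟩ := Finset.mem_image.1 hs
    rw [Finsupp.mem_support_iff] at hj ⊢
    intro h
    rw [mem_blockSubgroup.1 hx, if_pos (Nat.lt_succ_iff.1 (Finset.mem_range.1 hl))] at h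
    exact hj (by rw [mem_blockSubgroup.1 hx, h, ite_self])
  have hmax : ∀ s : ℕ × ℕ, ∃ l ∈ Finset.range (s.1 + 1), ∀ l' ∈ Finset.range (s.1 + 1),
      φ (s.1, s.2, l') ≤ φ (s.1, s.2, l) := fun s =>
    Finset.exists_max_image _ (fun l => φ (s.1, s.2, l)) ⟨0, by simp⟩
  choose L hL hLmax using hmax
  refine ⟨_, fun s => φ (s.1, s.2, L s), ?_, ?_, eq_sum_blockElt hx⟩
  · intro s hs t ht hst
    have := hφ (hsupp s hs _ (hL s)) (hsupp t ht _ (hL t)) hst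
    simp only [Prod.mk.injEq] at this
    exact Prod.ext this.1 this.2.1
  · intro s hs
    have hle : s.1 ≤ φ (s.1, s.2, L s) := by
      -- Pigeonhole: the block's `s.1 + 1` distinct labels are all at most the largest one.
      have hcard := Finset.card_le_card_of_injOn (s := Finset.range (s.1 + 1))
        (t := Finset.range (φ (s.1, s.2, L s) + 1)) (fun l => φ (s.1, s.2, l))
        (fun l hl => by
          have := hLmax s l hl
          simp only [Finset.coe_range, Set.mem_Iio]
          omega)
        (fun l hl l' hl' h => by
          have := hφ (hsupp s hs l hl) (hsupp s hs l' hl') h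
          simpa using this)
      simpa using hcard
    refine ⟨hle, ?_⟩
    have h := hφ' _ (hsupp s hs _ (hL s))
    have hl := Finset.mem_range.1 (hL s)
    simp only [Finset.mem_product, Finset.mem_range] at h
    by_contra hg
    rw [not_le] at hg
    exact h ⟨by omega, hg, by omega⟩

/-! ### The two T-sequences -/

/-- An enumeration of the basis. -/
noncomputable def basisSeq (n : ℕ) : BooleanGroup :=
  basisElt ((Denumerable.eqv (ℕ × ℕ × ℕ)).symm n)

/-- An enumeration of the block elements. -/
noncomputable def blockSeq (n : ℕ) : BooleanGroup :=
  blockElt ((Denumerable.eqv (ℕ × ℕ)).symm n)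

theorem tendsto_comp_eqv_symm {ι α : Type*} [Denumerable ι] {u : ι → α} {l : Filter α} :
    Tendsto (fun n => u ((Denumerable.eqv ι).symm n)) atTop l ↔ Tendsto u cofinite l := by
  rw [← Nat.cofinite_eq_atTop]
  constructor
  · intro h
    have := h.comp (Denumerable.eqv ι).injective.tendsto_cofinite
    simpa [Function.comp_def] using this
  · exact fun h => h.comp (Denumerable.eqv ι).symm.injective.tendsto_cofinite

/-- The topology of pointwise convergence. -/
noncomputable def pointwiseTopology : AddGroupTopology BooleanGroup :=
  letI : TopologicalSpace (ZMod 2) := ⊥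
  haveI : DiscreteTopology (ZMod 2) := ⟨rfl⟩
  ⟨TopologicalSpace.induced (Finsupp.coeFnAddHom : BooleanGroup →+ _) inferInstance,
    topologicalAddGroup_induced _⟩

theorem t2Space_pointwiseTopology :
    @T2Space BooleanGroup pointwiseTopology.toTopologicalSpace := by
  let : TopologicalSpace (ZMod 2) := ⊥
  have : DiscreteTopology (ZMod 2) := ⟨rfl⟩
  let := pointwiseTopology.toTopologicalSpace
  exact T2Space.of_injective_continuous (f := (Finsupp.coeFnAddHom : BooleanGroup →+ _))
    DFunLike.coe_injective continuous_induced_dom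

theorem convergesToZero_pointwiseTopology {a : ℕ → BooleanGroup}
    (ha : ∀ j, ∀ᶠ n in atTop, a n j = 0) : ConvergesToZero pointwiseTopology a := by
  let : TopologicalSpace (ZMod 2) := ⊥
  have : DiscreteTopology (ZMod 2) := ⟨rfl⟩
  let := pointwiseTopology.toTopologicalSpace
  have hi : IsInducing (Finsupp.coeFnAddHom : BooleanGroup →+ _) := ⟨rfl⟩
  refine hi.tendsto_nhds_iff.2 (tendsto_pi_nhds.2 fun j => ?_)
  exact tendsto_nhds_of_eventually_eq (ha j)

theorem not_discreteTopology_of_convergesToZero {G : Type*} [AddGroup G] {τ : AddGroupTopology G}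
    {a : ℕ → G} (h : ConvergesToZero τ a) (ha : ∀ n, a n ≠ 0) :
    ¬ @DiscreteTopology G τ.toTopologicalSpace := by
  intro hd
  let := τ.toTopologicalSpace
  have h' : Tendsto a atTop (𝓝 0) := h
  rw [nhds_discrete, tendsto_pure] at h'
  obtain ⟨n, hn⟩ := h'.exists
  exact ha n hn

theorem basisElt_ne_zero (j : ℕ × ℕ × ℕ) : basisElt j ≠ 0 := by
  simp [basisElt]

theorem blockElt_ne_zero (s : ℕ × ℕ) : blockElt s ≠ 0 := by
  intro h
  have := DFunLike.congr_fun h (s.1, s.2, 0)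
  simp [blockElt_apply] at this

theorem eventually_comp_eqv_symm {ι : Type*} [Denumerable ι] {p : ι → Prop}
    (h : {i | ¬ p i}.Finite) : ∀ᶠ n in atTop, p ((Denumerable.eqv ι).symm n) := by
  have := ((tendsto_comp_eqv_symm (ι := ι)).2 tendsto_id).eventually h.eventually_cofinite_notMem
  exact this.mono (by simp)

theorem convergesToZero_basisSeq : ConvergesToZero pointwiseTopology basisSeq := by
  refine convergesToZero_pointwiseTopology fun j => ?_
  refine eventually_comp_eqv_symm (p := fun i => basisElt i j = 0)
    ((Set.finite_singleton j).subset fun i hi => ?_)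
  by_contra h
  exact hi (Finsupp.single_eq_of_ne (Ne.symm h))

theorem convergesToZero_blockSeq : ConvergesToZero pointwiseTopology blockSeq := by
  refine convergesToZero_pointwiseTopology fun j => ?_
  refine eventually_comp_eqv_symm (p := fun i => blockElt i j = 0)
    ((Set.finite_singleton (j.1, j.2.1)).subset fun i hi => ?_)
  by_contra h
  exact hi ((blockElt_apply i j.1 j.2.1 j.2.2).trans (if_neg fun h' => h h'.1))

theorem isTSequence_basisSeq : IsTSequence basisSeq :=
  ⟨_, t2Space_pointwiseTopology, not_discreteTopology_of_convergesToZero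
    convergesToZero_basisSeq fun _ => basisElt_ne_zero _, convergesToZero_basisSeq⟩

theorem isTSequence_blockSeq : IsTSequence blockSeq :=
  ⟨_, t2Space_pointwiseTopology, not_discreteTopology_of_convergesToZero
    convergesToZero_blockSeq fun _ => blockElt_ne_zero _, convergesToZero_blockSeq⟩

/-! ### The join is a k_ω-group -/

/-- The join of the topologies determined by the basis and by the block elements. -/
noncomputable def joinedTopology : AddGroupTopology BooleanGroup :=
  joinTopology (strongestTopology basisSeq) (strongestTopology blockSeq)

theorem nhds_joinedTopology : @nhds _ joinedTopology.toTopologicalSpace 0 =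
    @nhds _ (strongestTopology basisSeq).toTopologicalSpace 0 ⊓
      @nhds _ (strongestTopology blockSeq).toTopologicalSpace 0 :=
  nhds_inf

theorem t2Space_joinedTopology : @T2Space _ joinedTopology.toTopologicalSpace :=
  have h : joinedTopology ≤ pointwiseTopology :=
    inf_le_left.trans
      ((isStrongestTopologyFor_strongestTopology _).2 _ convergesToZero_basisSeq)
  @T2Space.of_injective_continuous _ _ joinedTopology.toTopologicalSpace
    pointwiseTopology.toTopologicalSpace t2Space_pointwiseTopology id Function.injective_id
    (continuous_id_of_le h)

theorem tendsto_blockElt (m : ℕ) : Tendsto (fun n => blockElt (m, n)) atTop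
    (@nhds _ joinedTopology.toTopologicalSpace 0) := by
  rw [nhds_joinedTopology, tendsto_inf]
  constructor
  · let := (strongestTopology basisSeq).toTopologicalSpace
    have := (strongestTopology basisSeq).toIsTopologicalAddGroup
    have h : Tendsto basisElt cofinite (𝓝 0) :=
      tendsto_comp_eqv_symm.1 (isStrongestTopologyFor_strongestTopology basisSeq).1
    have hl : ∀ l ∈ Finset.range (m + 1), Tendsto (fun n => basisElt (m, n, l)) atTop (𝓝 0) := by
      intro l _
      rw [← Nat.cofinite_eq_atTop]
      refine h.comp (Function.Injective.tendsto_cofinite (f := fun n : ℕ => (m, n, l)) ?_)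
      intro n n' hn
      simpa using hn
    simpa [blockElt] using tendsto_finsetSum _ hl
  · have h : Tendsto blockElt cofinite
        (@nhds _ (strongestTopology blockSeq).toTopologicalSpace 0) :=
      tendsto_comp_eqv_symm.1 (isStrongestTopologyFor_strongestTopology blockSeq).1
    rw [← Nat.cofinite_eq_atTop]
    refine h.comp (Function.Injective.tendsto_cofinite (f := fun n : ℕ => (m, n)) ?_)
    intro n n' hn
    simpa using hn

theorem blockSums_mem_nhds (g : ℕ → ℕ) :
    blockSums blockElt g ∈ @nhds _ joinedTopology.toTopologicalSpace 0 := by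
  rw [nhds_joinedTopology]
  refine mem_of_superset ?_ (inter_avoidingSet_subset_blockSums g)
  refine inter_mem (mem_inf_of_right ?_) (mem_inf_of_left ?_)
  · refine (isStrongestTopologyFor_strongestTopology blockSeq).mem_nhds_of_filterBasis
      (subgroupFilterBasis blockSubgroup) ?_ rfl
    rintro _ rfl
    exact Eventually.of_forall fun n => blockElt_mem_blockSubgroup _
  · refine (isStrongestTopologyFor_strongestTopology basisSeq).mem_nhds_of_filterBasis
      avoidingBasis ?_ ⟨_, rfl⟩
    rintro _ ⟨f, rfl⟩
    refine eventually_comp_eqv_symm (p := fun i => basisElt i ∈ avoidingSet f)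
      ((f 0).finite_toSet.subset fun j hj => ?_)
    by_contra h
    exact hj (basisElt_mem_avoidingSet h)

theorem isKOmegaGroup_joinedTopology : IsKOmegaGroup joinedTopology := by
  let := joinedTopology.toTopologicalSpace
  have := joinedTopology.toIsTopologicalAddGroup
  exact ⟨t2Space_joinedTopology,
    exists_countable_compact_cover tendsto_blockElt blockSums_mem_nhds⟩

/-! ### The join is not determined by a T-sequence -/

/-- The elements supported in rows at most `M`. -/
def rowSubgroup (M : ℕ) : AddSubgroup BooleanGroup where
  carrier := {x | ∀ m n l, M < m → x (m, n, l) = 0}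
  zero_mem' := by simp
  add_mem' := by
    intro x y hx hy m n l hm
    simp [hx m n l hm, hy m n l hm]
  neg_mem' := by
    intro x hx m n l hm
    simp [hx m n l hm]

/-- A block of row m has label at least m, so by monotonicity its column is at least `g m`. -/
theorem eq_zero_of_mem_blockSums {g : ℕ → ℕ} (hg : Monotone g) {x : BooleanGroup}
    (hx : x ∈ blockSums blockElt g) {m n l : ℕ} (h : n < g m) : x (m, n, l) = 0 := by
  obtain ⟨S, ψ, -, hS, rfl⟩ := hx
  rw [Finsupp.finsetSum_apply]
  refine Finset.sum_eq_zero fun s hs => ?_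
  rw [blockElt_apply, if_neg]
  rintro ⟨rfl, -⟩
  have h1 := hS _ hs
  have h2 := hg h1.1
  simp only at h1 h2
  omega

theorem exists_eventually_mem_rowSubgroup {b : ℕ → BooleanGroup}
    (hb : ConvergesToZero joinedTopology b) : ∃ M, ∀ᶠ n in atTop, b n ∈ rowSubgroup M := by
  by_contra! hcon
  have h : ∀ M, ∃ k ≥ M, ∃ m n l, M < m ∧ b k (m, n, l) ≠ 0 := by
    intro M
    obtain ⟨k, hk, hkM⟩ := frequently_atTop.1 (hcon M) M
    by_contra! h'
    exact hkM fun m n l hm => h' k hk m n l hm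
  choose k hk m n l hm hne using h
  -- Partial sums make the bound monotone and, since `N < m N`, larger than `n N` at `m N`; the bad
  -- coefficient of `b (k N)` is thus forced to vanish.
  have hg : Monotone fun i => ∑ M ∈ Finset.range i, (n M + 1) := fun i j hij =>
    Finset.sum_le_sum_of_subset (Finset.range_mono hij)
  obtain ⟨N, hN⟩ := eventually_atTop.1 (hb (blockSums_mem_nhds _))
  refine hne N (eq_zero_of_mem_blockSums hg (hN _ (hk N)) ?_)
  exact Nat.lt_of_succ_le (Finset.single_le_sum (f := fun M => n M + 1)
    (fun _ _ => Nat.zero_le _) (Finset.mem_range.2 (hm N)))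

theorem not_isDeterminedByTSequence_joinedTopology :
    ¬ IsDeterminedByTSequence joinedTopology := by
  rintro ⟨b, -, hb⟩
  obtain ⟨M, hM⟩ := exists_eventually_mem_rowSubgroup hb.1
  have hmem := hb.mem_nhds_of_filterBasis (subgroupFilterBasis (rowSubgroup M))
    (by rintro _ rfl; exact hM) rfl
  obtain ⟨n, hn⟩ := ((tendsto_blockElt (M + 1)).eventually hmem).exists
  have := hn (M + 1) n 0 (Nat.lt_succ_self M)
  simp [blockElt_apply] at this

end BooleanGroup

theorem corollary1 :
    ∃ (G : Type) (_ : AddCommGroup G) (τ₁ τ₂ : AddGroupTopology G),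
      Countable G ∧
      IsDeterminedByTSequence τ₁ ∧ IsDeterminedByTSequence τ₂ ∧
      IsKOmegaGroup (joinTopology τ₁ τ₂) ∧
      ¬ IsDeterminedByTSequence (joinTopology τ₁ τ₂) :=
  ⟨BooleanGroup, inferInstance, strongestTopology BooleanGroup.basisSeq,
    strongestTopology BooleanGroup.blockSeq, inferInstance,
    ⟨_, BooleanGroup.isTSequence_basisSeq, isStrongestTopologyFor_strongestTopology _⟩,
    ⟨_, BooleanGroup.isTSequence_blockSeq, isStrongestTopologyFor_strongestTopology _⟩,
    BooleanGroup.isKOmegaGroup_joinedTopology,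
    BooleanGroup.not_isDeterminedByTSequence_joinedTopology⟩
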